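/- Let $(\Sigma,<)$ be a totally ordered alphabet (finiteness is not needed) and $\Sigma^+$ the set of nonempty words over $\Sigma$. Let $\prec$ be the lexicographic order on $\Sigma^*$ ($x\prec y$ iff $x$ is a proper prefix of $y$, or $x=ras$, $y=rbt$ with letters $a<b$), and let $\prec_{in}$ be the inverse lexicographic order, i.e. the lexicographic order on $\Sigma^*$ built on the inverse order of the alphabet (so a proper prefix of $y$ is still $\prec_{in} y$). Write $x\ll y$ if $x\prec y$ and $x$ is not a proper prefix of $y$, and $x\le_p y$ if $x$ is a prefix of $y$. A word $w\in\Sigma^+$ is an inverse Lyndon word if $s\prec w$ for each nonempty proper suffix $s$ of $w$. Let $p$ be an inverse Lyndon word that is a nonempty proper prefix of $w=pv$. A bounded right extension of $p$ (relative to $w$) is a nonempty prefix $\overline p$ of $v$ such that (1) $\overline p$ is an inverse Lyndon word, (2) $pz'$ is an inverse Lyndon word for each proper nonempty prefix $z'$ of $\overline p$, (3) $p\overline p$ is not an inverse Lyndon word, (4) $p\ll\overline p$. Each $w\in\Sigma^+$ that is not an inverse Lyndon word has exactly one such pair $(p,\overline p)$. The canonical inverse Lyndon factorization $\mathrm{ICFL}(w)$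 of $w\in\Sigma^+$ is defined recursively: if $w$ is an inverse Lyndon word, $\mathrm{ICFL}(w)=(w)$; otherwise let $(p,\overline p)$ be this pair, $w=pv$ and $\mathrm{ICFL}(v)=(m'_1,\dots,m'_{k'})$; then $\mathrm{ICFL}(w)=(p,m'_1,\dots,m'_{k'})$ if $\overline p\le_p m'_1$, and $\mathrm{ICFL}(w)=(pm'_1,m'_2,\dots,m'_{k'})$ otherwise (i.e. if $m'_1$ is a proper prefix of $\overline p$). One has $w=m_1\cdots m_k$ for $\mathrm{ICFL}(w)=(m_1,\dots,m_k)$. For $w=a_1\cdots a_n$ put $w[i,j]=a_i\cdots a_j$. **Statement.** Let $w\in\Sigma^+$, let $\mathrm{ICFL}(w)=(m_1,\dots,m_k)$, let $1\le r\le s\le k$ and $u=m_r\cdots m_s$. Let $first(u)=|m_1\cdots m_{r-1}|+1$ and $last(u)=|m_1\cdots m_s|$ be the positions in $w$ of the first and last letter of this occurrence of $u$. Then sorting with respect to $\prec_{in}$ the nonempty local suffixes of $w$ with respect to $u$ is compatible with sorting with respect to $\prec_{in}$ the corresponding global suffixes of $w$, that is, for all $i,j$ with $first(u)\le i<j\le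 last(u)$, $$w[i,last(u)]\prec_{in} w[j,last(u)]\iff w[i,n]\prec_{in} w[j,n].$$ -/

import Mathlib

/-! Words over a totally ordered alphabet `α` are elements of `List α`. -/

namespace Words

variable {α : Type*} [LinearOrder α]

/-- The lexicographic order `≺`: either `x` is a proper prefix of `y`, or at the first
difference the letter of `x` is smaller than the letter of `y`. -/
def LexLt (x y : List α) : Prop := List.Lex (fun a b : α => a < b) x y

/-- The inverse lexicographic order `≺_in`: the lexicographic order built on the inverse
order of the alphabet. -/
def InvLexLt (x y : List α) : Prop := List.Lex (fun a b : α => b < a) x y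

/-- `x ≪ y`: `x ≺ y` and `x` is not a proper prefix of `y`. -/
def StrongLexLt (x y : List α) : Prop := LexLt x y ∧ ¬ (x <+: y ∧ x ≠ y)

/-- A nonempty word is inverse Lyndon if it is greater than all of its proper nonempty
suffixes. -/
def IsInverseLyndon (w : List α) : Prop :=
  w ≠ [] ∧ ∀ s : List α, s <:+ w → s ≠ [] → s ≠ w → LexLt s w

/-- `q` is the bounded right extension of the nonempty proper prefix `p` of `w`. -/
structure IsBoundedRightExt (w p q : List α) : Prop where
  exists_suffix : ∃ v, w = p ++ v ∧ v ≠ [] ∧ q <+: v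
  left_ne_nil : p ≠ []
  left_inverseLyndon : IsInverseLyndon p
  ne_nil : q ≠ []
  inverseLyndon : IsInverseLyndon q
  append_prefix : ∀ z, z <+: q → z ≠ [] → z ≠ q → IsInverseLyndon (p ++ z)
  not_append : ¬ IsInverseLyndon (p ++ q)
  strongLexLt : StrongLexLt p q

/-! ### Well-definedness: a word that is not inverse Lyndon has exactly one nonempty proper
prefix with a bounded right extension -/

theorem strongLexLt_iff {x y : List α} : StrongLexLt x y ↔
    ∃ r a s b t, a < b ∧ x = r ++ a :: s ∧ y = r ++ b :: t := by
  constructor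
  · rintro ⟨h, hp⟩
    unfold LexLt at h
    induction h with
    | nil => exact absurd ⟨List.nil_prefix, by simp⟩ hp
    | @cons a l₁ l₂ h ih =>
      obtain ⟨r, a', s, b, t, hab, rfl, rfl⟩ := ih (by simpa using hp)
      exact ⟨a :: r, a', s, b, t, hab, rfl, rfl⟩
    | @rel a l₁ b l₂ h => exact ⟨[], a, l₁, b, l₂, h, rfl, rfl⟩
  · rintro ⟨r, a, s, b, t, hab, rfl, rfl⟩
    refine ⟨?_, ?_⟩
    · induction r with
      | nil => exact List.Lex.rel hab
      | cons c r ih => exact List.Lex.cons ih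
    · rintro ⟨h, -⟩
      rw [List.prefix_append_right_inj, List.cons_prefix_cons] at h
      exact hab.ne h.1

theorem StrongLexLt.append {x y : List α} (h : StrongLexLt x y) (u v : List α) :
    StrongLexLt (x ++ u) (y ++ v) := by
  obtain ⟨r, a, s, b, t, hab, rfl, rfl⟩ := strongLexLt_iff.1 h
  exact strongLexLt_iff.2 ⟨r, a, s ++ u, b, t ++ v, hab, by simp, by simp⟩

theorem LexLt.asymm {x y : List α} (h : LexLt x y) : ¬ LexLt y x := by
  unfold LexLt at *
  induction h with
  | nil => intro h; cases h
  | cons h ih =>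
    intro h'
    cases h' with
    | cons h' => exact ih h'
    | rel h' => exact lt_irrefl _ h'
  | rel h =>
    intro h'
    cases h' with
    | cons h' => exact lt_irrefl _ h
    | rel h' => exact lt_asymm h h'

theorem lexLt_total {x y : List α} (h : x ≠ y) : LexLt x y ∨ LexLt y x := by
  unfold LexLt
  induction x generalizing y with
  | nil =>
    cases y with
    | nil => exact absurd rfl h
    | cons b y => exact Or.inl List.Lex.nil
  | cons a x ih =>
    cases y with
    | nil => exact Or.inr List.Lex.nil
    | cons b y =>
      rcases lt_trichotomy a b with hab | rfl | hab
      · exact Or.inl (List.Lex.rel hab)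
      · rcases ih (y := y) (by rintro rfl; exact h rfl) with h1 | h1
        · exact Or.inl (List.Lex.cons h1)
        · exact Or.inr (List.Lex.cons h1)
      · exact Or.inr (List.Lex.rel hab)

theorem exists_strongLexLt_of_not {w : List α} (hw : w ≠ []) (h : ¬ IsInverseLyndon w) :
    ∃ s, s <:+ w ∧ s ≠ [] ∧ s ≠ w ∧ StrongLexLt w s := by
  unfold IsInverseLyndon at h
  push Not at h
  obtain ⟨s, hs, hs0, hsw, hlt⟩ := h hw
  refine ⟨s, hs, hs0, hsw, (lexLt_total hsw).resolve_left hlt, ?_⟩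
  rintro ⟨hp, hne⟩
  exact hne (hp.eq_of_length_le hs.length_le)

theorem not_isInverseLyndon_of {w s : List α} (hs : s <:+ w) (h : StrongLexLt w s) :
    ¬ IsInverseLyndon w := by
  intro hw
  have hne : s ≠ w := by
    rintro rfl
    exact h.1.asymm h.1
  have h0 : s ≠ [] := by
    rintro rfl
    have := h.1
    unfold LexLt at this
    cases this
  exact h.1.asymm (hw.2 s hs h0 hne)

theorem IsInverseLyndon.of_prefix {w p : List α} (hw : IsInverseLyndon w) (hp : p <+: w)
    (h0 : p ≠ []) : IsInverseLyndon p := by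
  by_contra hn
  obtain ⟨s, hs, -, -, hlt⟩ := exists_strongLexLt_of_not h0 hn
  obtain ⟨t, rfl⟩ := hp
  obtain ⟨c, rfl⟩ := hs
  exact not_isInverseLyndon_of (s := s ++ t) ⟨c, by simp⟩ (hlt.append t t) hw

theorem exists_isBoundedRightExt {w : List α} (hw : w ≠ []) (h : ¬ IsInverseLyndon w) :
    ∃ p q, IsBoundedRightExt w p q := by
  classical
  -- the shortest nonempty prefix which is not inverse Lyndon
  have hex : ∃ n, ∃ x : List α, x.length = n ∧ x <+: w ∧ x ≠ [] ∧ ¬ IsInverseLyndon x :=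
    ⟨_, w, rfl, List.prefix_rfl, hw, h⟩
  obtain ⟨x, hxn, hxw, hx0, hx⟩ := Nat.find_spec hex
  have hmin : ∀ z, z <+: x → z ≠ [] → z ≠ x → IsInverseLyndon z := by
    intro z hz hz0 hzx
    by_contra hn
    have hlt : z.length < Nat.find hex := by
      rw [← hxn]
      exact lt_of_le_of_ne hz.length_le fun e => hzx (hz.eq_of_length e)
    exact Nat.find_min hex hlt ⟨z, rfl, hz.trans hxw, hz0, hn⟩
  -- the shortest suffix which is much greater than it
  have hex2 : ∃ n, ∃ s : List α, s.length = n ∧ s <:+ x ∧ s ≠ [] ∧ s ≠ x ∧ StrongLexLt x s := by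
    obtain ⟨s, hs⟩ := exists_strongLexLt_of_not hx0 hx
    exact ⟨_, s, rfl, hs⟩
  obtain ⟨q, hqn, hqx, hq0, hqne, hlt⟩ := Nat.find_spec hex2
  have hmin2 : ∀ s, s <:+ x → s.length < q.length → ¬ StrongLexLt x s := by
    intro s hs hl hlt'
    rw [hqn] at hl
    refine Nat.find_min hex2 hl ⟨s, rfl, hs, ?_, ?_, hlt'⟩
    · rintro rfl
      have := hlt'.1
      unfold LexLt at this
      cases this
    · rintro rfl
      exact hlt'.1.asymm hlt'.1
  obtain ⟨p, rfl⟩ := hqx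
  have hp0 : p ≠ [] := by
    rintro rfl
    exact hqne rfl
  have hpq : p ≠ p ++ q := by simpa using hq0
  have hpl : IsInverseLyndon p := hmin p (List.prefix_append _ _) hp0 hpq
  obtain ⟨r, a, s, b, t, hab, hx1, hq1⟩ := strongLexLt_iff.1 hlt
  -- `q` is `r` followed by a single letter
  have ht : t = [] := by
    by_contra ht
    subst hq1
    refine not_isInverseLyndon_of (w := p ++ (r ++ [b])) (s := r ++ [b]) ⟨p, rfl⟩ ?_
      (hmin _ ⟨t, by simp⟩ (by simp) (by simpa using Ne.symm ht))
    have hpre : r ++ [a] <+: p ++ (r ++ [b]) := by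
      refine List.prefix_of_prefix_length_le (l₃ := p ++ (r ++ b :: t)) ⟨s, by simp [hx1]⟩
        ⟨t, by simp⟩ (by simp)
    obtain ⟨s', hs'⟩ := hpre
    exact strongLexLt_iff.2 ⟨r, a, s', b, [], hab, by rw [← hs']; simp, rfl⟩
  subst ht
  subst hq1
  -- `r` is shorter than `p`
  have hrp : r.length < p.length := by
    by_contra hle
    push Not at hle
    have hrx : r <+: p ++ (r ++ [b]) := ⟨a :: s, hx1.symm⟩
    obtain ⟨r1, rfl⟩ : p <+: r :=
      List.prefix_of_prefix_length_le (List.prefix_append _ _) hrx hle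
    have hpos : 0 < p.length := List.length_pos_iff.2 hp0
    have h1 : r1 ++ a :: s = p ++ r1 ++ [b] := by
      have := hx1
      simp only [List.append_assoc] at this
      have := List.append_cancel_left this
      simpa using this.symm
    obtain ⟨c, hc⟩ : r1 ++ [a] <+: p ++ r1 := by
      refine List.prefix_of_prefix_length_le (l₃ := p ++ r1 ++ [b]) ⟨s, by simp [← h1]⟩
        ⟨[b], by simp⟩ (by simp; omega)
    refine hmin2 (r1 ++ [b]) ⟨p ++ p, by simp⟩ (by simp; omega) ?_
    refine strongLexLt_iff.2 ⟨r1, a, c ++ a :: s, b, [], hab, ?_, rfl⟩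
    rw [hx1, ← hc]
    simp
  have hrap : r ++ [a] <+: p := by
    refine List.prefix_of_prefix_length_le (l₃ := p ++ (r ++ [b])) ⟨s, by simp [hx1]⟩
      (List.prefix_append _ _) (by simp; omega)
  obtain ⟨p', hp'⟩ := hrap
  refine ⟨p, r ++ [b], ?_, hp0, hpl, by simp, ⟨by simp, ?_⟩, ?_, hx, ?_⟩
  · obtain ⟨e, he⟩ := hxw
    exact ⟨r ++ [b] ++ e, by simp [← he], by simp, List.prefix_append _ _⟩
  · intro u hu hu0 hune
    by_contra hn
    have hlen : u.length < (r ++ [b]).length :=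
      lt_of_le_of_ne hu.length_le fun e => hune (hu.eq_of_length e)
    have hux : u <:+ p ++ (r ++ [b]) := hu.trans (List.suffix_append _ _)
    have hqu := (lexLt_total hune).resolve_left hn
    have hqu' : StrongLexLt (r ++ [b]) u :=
      ⟨hqu, fun ⟨hp, hne⟩ => hne (hp.eq_of_length_le hlen.le)⟩
    -- then `x ≪ u`, since `r` is a prefix of `x` and `b` exceeds the next letter
    obtain ⟨r', a', s', b', t', hab', h1, h2⟩ := strongLexLt_iff.1 hqu'
    refine hmin2 u hux hlen ?_
    have hl : r'.length < r.length := by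
      have := congrArg List.length h2
      simp at hlen this
      omega
    obtain ⟨d, hd⟩ : r' ++ [a'] <+: r := by
      refine List.prefix_of_prefix_length_le (l₃ := r ++ [b]) ⟨s', by simp [h1]⟩
        (List.prefix_append _ _) (by simp; omega)
    exact strongLexLt_iff.2 ⟨r', a', d ++ a :: s, b', t', hab', by rw [hx1, ← hd]; simp, h2⟩
  · intro z hz hz0 hzne
    exact hmin _ ((List.prefix_append_right_inj p).2 hz) (by simp [hp0]) (by simpa using hzne)
  · exact strongLexLt_iff.2 ⟨r, a, p', b, [], hab, by rw [← hp']; simp, rfl⟩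

theorem IsBoundedRightExt.prefix_word {w p q : List α} (h : IsBoundedRightExt w p q) :
    p ++ q <+: w := by
  obtain ⟨v, rfl, -, hq⟩ := h.exists_suffix
  exact (List.prefix_append_right_inj p).2 hq

theorem IsBoundedRightExt.isInverseLyndon_of_prefix {w p q z : List α}
    (h : IsBoundedRightExt w p q) (hz : z <+: p ++ q) (h0 : z ≠ []) (hne : z ≠ p ++ q) :
    IsInverseLyndon z := by
  rcases List.prefix_or_prefix_of_prefix hz (List.prefix_append p q) with hz' | ⟨y, rfl⟩
  · exact h.left_inverseLyndon.of_prefix hz' h0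
  · have hy := (List.prefix_append_right_inj p).1 hz
    by_cases hy0 : y = []
    · subst hy0
      simpa using h.left_inverseLyndon
    · exact h.append_prefix y hy hy0 (by simpa using hne)

/-- With `p = r a x` and `q = r b`, `a < b`. -/
theorem IsBoundedRightExt.shape {w p q : List α} (h : IsBoundedRightExt w p q) :
    ∃ r a x b, a < b ∧ p = r ++ a :: x ∧ q = r ++ [b] := by
  obtain ⟨r, a, s, b, t, hab, hp, hq⟩ := strongLexLt_iff.1 h.strongLexLt
  refine ⟨r, a, s, b, hab, hp, ?_⟩
  suffices t = [] by rw [hq, this]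
  by_contra ht
  refine not_isInverseLyndon_of (w := p ++ (r ++ [b])) (s := r ++ [b]) ⟨p, rfl⟩ ?_
    (h.append_prefix _ ⟨t, by simp [hq]⟩ (by simp) (by simpa [hq] using Ne.symm ht))
  exact strongLexLt_iff.2 ⟨r, a, s ++ (r ++ [b]), b, [], hab, by rw [hp]; simp, rfl⟩

theorem IsBoundedRightExt.unique {w p q p' q' : List α} (h : IsBoundedRightExt w p q)
    (h' : IsBoundedRightExt w p' q') : p = p' ∧ q = q' := by
  have aux : ∀ {p q p' q' : List α}, IsBoundedRightExt w p q → IsBoundedRightExt w p' q' →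
      p ++ q <+: p' ++ q' → p ++ q = p' ++ q' := by
    intro p q p' q' h h' hp
    by_contra hne
    exact h.not_append (h'.isInverseLyndon_of_prefix hp (by simp [h.ne_nil]) hne)
  have heq : p ++ q = p' ++ q' := by
    rcases List.prefix_or_prefix_of_prefix h.prefix_word h'.prefix_word with hp | hp
    · exact aux h h' hp
    · exact (aux h' h hp).symm
  have aux2 : ∀ {p q p' q' : List α}, IsBoundedRightExt w p q → IsBoundedRightExt w p' q' →
      p ++ q = p' ++ q' → ¬ q'.length < q.length := by
    intro p q p' q' h h' heq hlt
    obtain ⟨r, a, x, b, hab, rfl, rfl⟩ := h.shape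
    obtain ⟨r', a', x', b', hab', rfl, rfl⟩ := h'.shape
    have hl : r'.length < r.length := by simpa using hlt
    obtain ⟨d, hd⟩ : r' ++ [a'] <+: r := by
      refine List.prefix_of_prefix_length_le (l₃ := r ++ a :: x ++ (r ++ [b]))
        ⟨x' ++ (r' ++ [b']), by rw [heq]; simp⟩ ⟨a :: x ++ (r ++ [b]), by simp⟩
        (by simp; omega)
    have hsuf : r' ++ [b'] <:+ r ++ [b] := by
      refine List.suffix_of_suffix_length_le (l₃ := r ++ a :: x ++ (r ++ [b])) ?_
        (List.suffix_append _ _) hlt.le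
      rw [heq]
      exact List.suffix_append _ _
    refine not_isInverseLyndon_of hsuf ?_ h.inverseLyndon
    exact strongLexLt_iff.2 ⟨r', a', d ++ [b], b', [], hab', by rw [← hd]; simp, rfl⟩
  have hlen : q.length = q'.length :=
    le_antisymm (not_lt.1 (aux2 h h' heq)) (not_lt.1 (aux2 h' h heq.symm))
  exact List.append_inj' heq hlen

theorem existsUnique_isBoundedRightExt {w : List α} (h : w ≠ [] ∧ ¬ IsInverseLyndon w) :
    ∃! b : List α × List α, IsBoundedRightExt w b.1 b.2 := by
  obtain ⟨p, q, hpq⟩ := exists_isBoundedRightExt h.1 h.2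
  refine ⟨(p, q), hpq, ?_⟩
  rintro ⟨p', q'⟩ h'
  obtain ⟨rfl, rfl⟩ := h'.unique hpq
  rfl

/-! ### The canonical inverse Lyndon factorization -/

/-- The unique pair `(p, q)` with `q` the bounded right extension of the prefix `p` of `w`. -/
noncomputable def brePair (w : List α) (h : w ≠ [] ∧ ¬ IsInverseLyndon w) : List α × List α :=
  (existsUnique_isBoundedRightExt h).choose

theorem brePair_spec (w : List α) (h : w ≠ [] ∧ ¬ IsInverseLyndon w) :
    IsBoundedRightExt w (brePair w h).1 (brePair w h).2 :=
  (existsUnique_isBoundedRightExt h).choose_spec.1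

theorem length_drop_brePair_lt (w : List α) (h : w ≠ [] ∧ ¬ IsInverseLyndon w) :
    (w.drop (brePair w h).1.length).length < w.length := by
  have h1 := List.length_pos_iff.2 (brePair_spec w h).left_ne_nil
  have h2 := List.length_pos_iff.2 h.1
  rw [List.length_drop]
  omega

/-- One recursive step: given the pair `(p, q)` and the factorization of the word `v` that
follows `p`, prepend `p` as a new factor if `q` is a prefix of the first factor of `v`, and
otherwise (then the first factor is a proper prefix of `q`, both being prefixes of `v`)
glue `p` to that first factor. -/
noncomputable def icflStep (p q : List α) : List (List α) → List (List α)
  | [] => [p]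
  | m :: ms => open Classical in if q <+: m then p :: m :: ms else (p ++ m) :: ms

open Classical in
/-- The canonical inverse Lyndon factorization `ICFL(w)` of a nonempty word `w` (and the empty
sequence for the empty word). -/
noncomputable def ICFL (w : List α) : List (List α) :=
  if h : w ≠ [] ∧ ¬ IsInverseLyndon w then
    icflStep (brePair w h).1 (brePair w h).2 (ICFL (w.drop (brePair w h).1.length))
  else if w = [] then [] else [w]
termination_by w.length
decreasing_by exact length_drop_brePair_lt w h

theorem flatten_icflStep (p q : List α) (L : List (List α)) :
    (icflStep p q L).flatten = p ++ L.flatten := by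
  cases L with
  | nil => simp [icflStep]
  | cons m ms =>
    simp only [icflStep]
    split_ifs <;> simp

/-- The factors of `ICFL(w)` do multiply to `w`. -/
theorem flatten_ICFL (w : List α) : (ICFL w).flatten = w := by
  induction hn : w.length using Nat.strong_induction_on generalizing w with
  | _ n ih =>
    subst hn
    rw [ICFL]
    split_ifs with h h'
    · rw [flatten_icflStep, ih _ (length_drop_brePair_lt w h) _ rfl]
      obtain ⟨v, hv, -, -⟩ := (brePair_spec w h).exists_suffix
      generalize (brePair w h).1 = p at hv
      subst hv
      simp
    · simp [h']
    · simp

/-! ### Local and global suffixes -/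

/-- `w[i, j] = a_i ⋯ a_j` for `w = a_1 ⋯ a_n` and positions `1 ≤ i ≤ j ≤ n`. -/
def subword (w : List α) (i j : ℕ) : List α := (w.take j).drop (i - 1)

/-- For the factor `u` of `w` that occupies the positions `first, …, last` (counted from `1`):
sorting by `R` the nonempty local suffixes `w[i, last]` of `w` with respect to `u` is
compatible with sorting by `R` the corresponding global suffixes `w[i, |w|]`. -/
def SortingCompatible (R : List α → List α → Prop) (w : List α) (first last : ℕ) : Prop :=
  ∀ i j : ℕ, first ≤ i → i < j → j ≤ last →
    (R (subword w i last) (subword w j last) ↔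
      R (subword w i w.length) (subword w j w.length))

end Words

namespace Words

/-! Of two suffixes of `u`, the shorter, `y`, is a suffix of the longer, `x`. If neither is a prefix
of the other, their first difference decides the order, and appending the rest `z` of the word
changes nothing. Otherwise `x = yt` with `t` a nonempty suffix of `u`, and `y` precedes `x` in the
inverse order. This survives appending `z` as soon as `t ≪ z`: then `ytz` has the smaller letter at
its first difference with `yz`.

So it suffices that every nonempty suffix of `u` is `≪` the next factor. This follows from a
separation property of the factorization: every nonempty suffix of a factor is `≪` every later
factor (`pairwise_ICFL`). It is proved along the recursion. When `p` becomes a factor, one needs `t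
≪ q` for all nonempty suffixes `t` of `p`, where the difficult case is a border `t` of `p`
(`not_prefix_of_border`). When `p` is glued to `m`, the property passes from `m` to `pm` because
`pm` is inverse Lyndon and begins with `m`. -/

theorem subword_append_left {α : Type*} {x u z : List α} {i : ℕ} (h : x.length + 1 ≤ i) :
    subword (x ++ u ++ z) i (x.length + u.length) = u.drop (i - 1 - x.length) := by
  rw [subword, ← List.length_append, List.take_left, List.drop_append,
    List.drop_eq_nil_of_le (by omega), List.nil_append]

variable {α : Type*} [LinearOrder α]

/-! ### First differences and suffixes of inverse Lyndon words -/

theorem StrongLexLt.trans {x y z : List α} (h : StrongLexLt x y) (h' : StrongLexLt y z) :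
    StrongLexLt x z := by
  obtain ⟨r, a, s, b, t, hab, rfl, rfl⟩ := strongLexLt_iff.1 h
  obtain ⟨r', a', s', b', t', hab', he, rfl⟩ := strongLexLt_iff.1 h'
  rcases lt_trichotomy r.length r'.length with hl | hl | hl
  · obtain ⟨d, rfl⟩ : r ++ [b] <+: r' :=
      List.prefix_of_prefix_length_le (l₃ := r ++ b :: t) ⟨t, by simp⟩
        ⟨a' :: s', he.symm⟩ (by simp; omega)
    exact strongLexLt_iff.2 ⟨r, a, s, b, d ++ b' :: t', hab, rfl, by simp⟩
  · obtain ⟨rfl, h2⟩ := List.append_inj he hl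
    obtain ⟨rfl, -⟩ := List.cons.inj h2
    exact strongLexLt_iff.2 ⟨r, a, s, b', t', hab.trans hab', rfl, rfl⟩
  · obtain ⟨d, rfl⟩ : r' ++ [a'] <+: r :=
      List.prefix_of_prefix_length_le (l₃ := r ++ b :: t) ⟨s', by simp [he]⟩
        ⟨b :: t, rfl⟩ (by simp; omega)
    exact strongLexLt_iff.2 ⟨r', a', d ++ a :: s, b', t', hab', by simp, rfl⟩

/-- Two words neither of which is a prefix of the other have a first difference. -/
theorem strongLexLt_or_of_not_prefix {x y : List α} (h : ¬ x <+: y) (h' : ¬ y <+: x) :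
    StrongLexLt x y ∨ StrongLexLt y x := by
  have hne : x ≠ y := by
    rintro rfl
    exact h List.prefix_rfl
  exact (lexLt_total hne).imp (fun hl => ⟨hl, fun hp => h hp.1⟩) fun hl => ⟨hl, fun hp => h' hp.1⟩

theorem IsInverseLyndon.not_strongLexLt {w s : List α} (hw : IsInverseLyndon w) (hs : s <:+ w) :
    ¬ StrongLexLt w s :=
  fun h => not_isInverseLyndon_of hs h hw

theorem IsInverseLyndon.prefix_or_strongLexLt {w s : List α} (hw : IsInverseLyndon w)
    (hs : s <:+ w) : s <+: w ∨ StrongLexLt s w := by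
  by_contra hn
  push Not at hn
  have hws : ¬ w <+: s := fun hp => hn.1 (hp.eq_of_length_le hs.length_le ▸ List.prefix_rfl)
  exact (strongLexLt_or_of_not_prefix hn.1 hws).elim hn.2 (hw.not_strongLexLt hs)

theorem StrongLexLt.append_left {x y : List α} (h : StrongLexLt x y) (u : List α) :
    StrongLexLt (u ++ x) (u ++ y) := by
  obtain ⟨r, a, s, b, t, hab, rfl, rfl⟩ := strongLexLt_iff.1 h
  exact strongLexLt_iff.2 ⟨u ++ r, a, s, b, t, hab, by simp, by simp⟩

/-! ### Suffixes of a prefix against its bounded right extension -/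

/-- A nonempty border of a prefix is not a proper prefix of its bounded right extension. -/
theorem IsBoundedRightExt.not_prefix_of_border {w p q r t : List α} {a b : α}
    (h : IsBoundedRightExt w p q) (hab : a < b) (hq : q = r ++ [b]) (hp : r ++ [a] <+: p)
    (ht : t <:+ p) (ht0 : t ≠ []) : ¬ t <+: r := by
  rintro ⟨r', rfl⟩
  obtain ⟨x, rfl⟩ := hp
  subst hq
  -- With `r = tr'`, the inverse Lyndon word `p(tr')` begins with `tr'a` and ends with `ttr'`, while
  -- the inverse Lyndon word `q = tr'b` ends with `r'b`. Cancelling the leading `t` forbids `r'a ≪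
  -- tr'`, and comparing `q` with its suffix forbids `tr' ≪ r'b`.
  have hL := h.append_prefix (t ++ r') (List.prefix_append _ _) (by simp [ht0]) (by simp)
  have hQ := h.inverseLyndon
  have h1 : ¬ StrongLexLt (r' ++ [a]) (t ++ r') := by
    intro hc
    obtain ⟨y, hy⟩ := ht
    refine hL.not_strongLexLt (s := t ++ (t ++ r')) ⟨y, ?_⟩ ?_
    · rw [← hy]
      simp
    simpa using (hc.append (x ++ (t ++ r')) []).append_left t
  have h2 : ¬ StrongLexLt (t ++ r') (r' ++ [b]) := fun hc =>
    hQ.not_strongLexLt (s := r' ++ [b]) ⟨t, by simp⟩ (by simpa using hc.append [b] [])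
  have hlen : 0 < t.length := List.length_pos_iff.2 ht0
  -- If `r'` is a prefix of `tr'`, let `e` be the letter of `tr'` after it: either `e < b` or `a < b
  -- ≤ e`, and both are forbidden. Otherwise a first difference inside `r'` gives one of the two
  -- forbidden relations.
  by_cases hr : r' <+: t ++ r'
  · obtain ⟨d, hd⟩ := hr
    cases d with
    | nil =>
      have := congrArg List.length hd
      simp at this
      exact ht0 this
    | cons e d =>
      rcases lt_or_ge e b with he | he
      · exact h2 (strongLexLt_iff.2 ⟨r', e, d, b, [], he, hd.symm, rfl⟩)
      · exact h1 (strongLexLt_iff.2 ⟨r', a, [], e, d, hab.trans_le he, rfl, hd.symm⟩)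
  · have hr' : ¬ t ++ r' <+: r' := by
      intro hp
      have := hp.length_le
      simp at this
      exact ht0 this
    rcases strongLexLt_or_of_not_prefix hr hr' with hc | hc
    · exact h1 (by simpa using hc.append [a] [])
    · exact h2 (by simpa using hc.append [] [b])

theorem StrongLexLt.of_append_left {x y u : List α} (h : StrongLexLt x y) (hu : x <+: u) :
    StrongLexLt u y := by
  obtain ⟨t, rfl⟩ := hu
  simpa using h.append t []

/-- A suffix of `p` that is not a border is `≪ p ≪ q`. A border is not a prefix of `r`, hence is
longer than `r` and begins with `ra`, whereas `q = rb`. -/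
theorem IsBoundedRightExt.strongLexLt_of_suffix {w p q t : List α}
    (h : IsBoundedRightExt w p q) (ht : t <:+ p) (ht0 : t ≠ []) : StrongLexLt t q := by
  rcases h.left_inverseLyndon.prefix_or_strongLexLt ht with hp | hlt
  · obtain ⟨r, a, x, b, hab, hpr, hq⟩ := h.shape
    have hra : r ++ [a] <+: p := ⟨x, by simp [hpr]⟩
    have hn := h.not_prefix_of_border hab hq hra ht ht0
    have hlt : r.length < t.length := by
      by_contra hle
      exact hn (List.prefix_of_prefix_length_le hp ⟨a :: x, hpr.symm⟩ (by omega))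
    have : r ++ [a] <+: t := List.prefix_of_prefix_length_le hra hp (by simpa using hlt)
    refine StrongLexLt.of_append_left ?_ this
    exact strongLexLt_iff.2 ⟨r, a, [], b, [], hab, rfl, hq⟩
  · exact hlt.trans h.strongLexLt

/-! ### Separation of the factors -/

/-- Every nonempty suffix of `x` is `≪ y`. -/
def SuffixesStrongLexLt (x y : List α) : Prop :=
  ∀ t, t <:+ x → t ≠ [] → StrongLexLt t y

/-- This is the gluing case. A proper prefix `m` of `q = rb` is a prefix of `r`, hence of `p`, so
`pm` begins with `m` and `pm ≪ c`. A suffix of `pm` longer than `m` is either `≪ pm` or a prefix of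
`pm`; in the latter case it begins with `m` as well. -/
theorem IsBoundedRightExt.suffixesStrongLexLt_append {w p q m c : List α}
    (h : IsBoundedRightExt w p q) (hm : m <+: q) (hm0 : m ≠ []) (hmq : m ≠ q)
    (hc : SuffixesStrongLexLt m c) : SuffixesStrongLexLt (p ++ m) c := by
  intro t ht ht0
  by_cases hl : t.length ≤ m.length
  · exact hc t (List.suffix_of_suffix_length_le ht (List.suffix_append _ _) hl) ht0
  have hL := h.append_prefix m hm hm0 hmq
  have hmc := hc m List.suffix_rfl hm0
  obtain ⟨r, a, x, b, hab, hpr, hq⟩ := h.shape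
  have hmr : m <+: r := by
    rw [hq] at hm hmq
    exact (List.prefix_concat_iff.1 hm).resolve_left hmq
  have hmpm : m <+: p ++ m :=
    (hmr.trans (hpr ▸ List.prefix_append _ _)).trans (List.prefix_append _ _)
  rcases hL.prefix_or_strongLexLt ht with hp | hlt
  · exact hmc.of_append_left (List.prefix_of_prefix_length_le hmpm hp (by omega))
  · exact hlt.trans (hmc.of_append_left hmpm)

/-- The factors of `ICFL(w)` are nonempty, and every nonempty suffix of a factor is `≪` all
later factors. -/
theorem pairwise_ICFL (w : List α) :
    (∀ m ∈ ICFL w, m ≠ []) ∧ (ICFL w).Pairwise SuffixesStrongLexLt := by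
  induction hn : w.length using Nat.strong_induction_on generalizing w with
  | _ n ih =>
    subst hn
    rw [ICFL]
    split_ifs with h h'
    · have hb := brePair_spec w h
      have hv := ih _ (length_drop_brePair_lt w h) _ rfl
      have hfl := flatten_ICFL (w.drop (brePair w h).1.length)
      obtain ⟨v, hwv, -, hqv⟩ := hb.exists_suffix
      generalize (brePair w h).1 = p at *
      generalize (brePair w h).2 = q at *
      have hdrop : w.drop p.length = v := by simp [hwv]
      rw [hdrop] at hv hfl ⊢
      generalize ICFL v = L at *
      cases L with
      | nil => simpa [icflStep] using hb.left_ne_nil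
      | cons m ms =>
        obtain ⟨hne, hpw⟩ := hv
        rw [List.pairwise_cons] at hpw
        simp only [List.forall_mem_cons] at hne
        simp only [icflStep]
        split_ifs with hqm
        · refine ⟨by simpa using ⟨hb.left_ne_nil, hne⟩, ?_⟩
          -- Since `m` extends `q`, the relation `t ≪ q` persists; later factors are reached through
          -- `m ≪ c` by transitivity.
          have hpm : SuffixesStrongLexLt p m := by
            intro t ht ht0
            obtain ⟨d, rfl⟩ := hqm
            simpa using (hb.strongLexLt_of_suffix ht ht0).append [] d
          refine List.pairwise_cons.2 ⟨?_, List.pairwise_cons.2 hpw⟩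
          refine List.forall_mem_cons.2 ⟨hpm, fun c hc t ht ht0 => ?_⟩
          exact (hpm t ht ht0).trans (hpw.1 c hc m List.suffix_rfl hne.1)
        · have hmv : m <+: v := ⟨ms.flatten, by simpa using hfl⟩
          have hmq : m <+: q := (List.prefix_or_prefix_of_prefix hqv hmv).resolve_left hqm
          have hmne : m ≠ q := by
            rintro rfl
            exact hqm List.prefix_rfl
          refine ⟨by simpa [hne.1] using hne.2, List.pairwise_cons.2 ⟨fun c hc => ?_, hpw.2⟩⟩
          exact hb.suffixesStrongLexLt_append hmq hne.1 hmne (hpw.1 c hc)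
    · simp
    · simpa using h'

/-- A nonempty suffix of a product begins with a nonempty suffix of one factor, and that beginning
already contains the first difference with `c`. -/
theorem strongLexLt_of_suffix_flatten {L : List (List α)} {c t : List α}
    (h : ∀ m ∈ L, SuffixesStrongLexLt m c) (ht : t <:+ L.flatten) (ht0 : t ≠ []) :
    StrongLexLt t c := by
  induction L with
  | nil => simp_all
  | cons m L ih =>
    rw [List.forall_mem_cons] at h
    rw [List.flatten_cons] at ht
    by_cases hl : t.length ≤ L.flatten.length
    · exact ih h.2 (List.suffix_of_suffix_length_le ht (List.suffix_append _ _) hl)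
    · obtain ⟨t', rfl⟩ : L.flatten <:+ t :=
        List.suffix_of_suffix_length_le (List.suffix_append _ _) ht (by omega)
      have ht' : t' <:+ m := by
        obtain ⟨d, hd⟩ := ht
        exact ⟨d, List.append_cancel_right (by simpa using hd)⟩
      have h0 : t' ≠ [] := by
        rintro rfl
        simp at hl
      exact (h.1 t' ht' h0).of_append_left (List.prefix_append _ _)

/-! ### Local and global order of suffixes -/

theorem invLexLt_append_cons_iff {r s t : List α} {a b : α} (hab : a ≠ b) :
    InvLexLt (r ++ a :: s) (r ++ b :: t) ↔ b < a := by
  unfold InvLexLt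
  induction r with
  | nil =>
    refine ⟨fun h => ?_, fun h => List.Lex.rel h⟩
    cases h with
    | cons _ => exact absurd rfl hab
    | rel h => exact h
  | cons c r ih =>
    refine ⟨fun h => ?_, fun h => List.Lex.cons (ih.2 h)⟩
    cases h with
    | cons h => exact ih.1 h
    | rel h => exact absurd h (lt_irrefl _)

theorem not_invLexLt_append (y t : List α) : ¬ InvLexLt (y ++ t) y := by
  unfold InvLexLt
  induction y with
  | nil => intro h; cases h
  | cons c y ih =>
    intro h
    cases h with
    | cons h => exact ih h
    | rel h => exact lt_irrefl _ h

/-- Appending a word `z` to a word and to one of its suffixes does not change their inverse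
lexicographic order, if `z` is much greater than every nonempty suffix of the word. -/
theorem invLexLt_append_iff {x y z : List α} (hyx : y <:+ x) (hne : y ≠ x)
    (hz : SuffixesStrongLexLt x z) : InvLexLt x y ↔ InvLexLt (x ++ z) (y ++ z) := by
  by_cases hp : y <+: x
  · obtain ⟨t, rfl⟩ := hp
    have ht0 : t ≠ [] := by simpa using hne
    refine iff_of_false (not_invLexLt_append y t) ?_
    obtain ⟨r, a, s, b, s', hab, rfl, rfl⟩ :=
      strongLexLt_iff.1 (hz t (List.suffix_append _ _) ht0)
    have := invLexLt_append_cons_iff (r := y ++ r) (s := s ++ (r ++ b :: s')) (t := s') hab.ne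
    simp only [List.append_assoc, List.cons_append] at this ⊢
    rw [this]
    exact hab.asymm
  · have hp' : ¬ x <+: y := fun h => hne (hyx.eq_of_length_le h.length_le)
    obtain ⟨r, a, s, b, t, hab, rfl, rfl⟩ :
        ∃ r a s b t, a ≠ b ∧ x = r ++ a :: s ∧ y = r ++ b :: t := by
      rcases strongLexLt_or_of_not_prefix hp' hp with h | h
      · obtain ⟨r, a, s, b, t, hab, h1, h2⟩ := strongLexLt_iff.1 h
        exact ⟨r, a, s, b, t, hab.ne, h1, h2⟩
      · obtain ⟨r, a, s, b, t, hab, h1, h2⟩ := strongLexLt_iff.1 h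
        exact ⟨r, b, t, a, s, hab.ne', h2, h1⟩
    simp only [List.append_assoc, List.cons_append, invLexLt_append_cons_iff hab]

theorem sortingCompatible_of_suffixesStrongLexLt {x u z : List α}
    (hz : z = [] ∨ SuffixesStrongLexLt u z) :
    SortingCompatible InvLexLt (x ++ u ++ z) (x.length + 1) (x.length + u.length) := by
  intro i j hi hij hj
  have key : ∀ k, x.length + 1 ≤ k → k ≤ x.length + u.length →
      subword (x ++ u ++ z) k (x ++ u ++ z).length = u.drop (k - 1 - x.length) ++ z := by
    intro k hk hk'
    rw [subword, List.take_length, List.append_assoc, List.drop_append,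
      List.drop_eq_nil_of_le (by omega), List.nil_append, List.drop_append_of_le_length (by omega)]
  rw [key i hi (by omega), key j (by omega) hj, subword_append_left hi,
    subword_append_left (hi.trans hij.le)]
  rcases hz with rfl | hz
  · simp
  · have hsuf : u.drop (j - 1 - x.length) <:+ u.drop (i - 1 - x.length) :=
      List.drop_suffix_drop_left u (by omega)
    refine invLexLt_append_iff hsuf (fun h => ?_)
      fun t ht => hz t (ht.trans (List.drop_suffix _ _))
    have := congrArg List.length h
    simp only [List.length_drop] at this
    omega

end Words

theorem mainTheorem2 {α : Type*} [LinearOrder α] (w : List α) (hw : w ≠ [])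
    (m : List (List α)) (hm : Words.ICFL w = m)
    (r s : ℕ) (hr : 1 ≤ r) (hrs : r ≤ s) (hs : s ≤ m.length)
    (x u : List α)
    (hx : x = (m.take (r - 1)).flatten)
    (hu : u = ((m.take s).drop (r - 1)).flatten) :
    Words.SortingCompatible Words.InvLexLt w (x.length + 1) (x.length + u.length) := by
  have hxu : (m.take s).flatten = x ++ u := by
    rw [hx, hu, ← List.flatten_append]
    congr 1
    conv_lhs => rw [← List.take_append_drop (r - 1) (m.take s), List.take_take,
      min_eq_left (by omega)]
  have hwm : w = x ++ u ++ (m.drop s).flatten := by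
    rw [← hxu, ← List.flatten_append, List.take_append_drop, ← hm, Words.flatten_ICFL]
  rw [hwm]
  apply Words.sortingCompatible_of_suffixesStrongLexLt
  have hpw : (m.take s ++ m.drop s).Pairwise Words.SuffixesStrongLexLt := by
    rw [List.take_append_drop, ← hm]
    exact (Words.pairwise_ICFL w).2
  rw [List.pairwise_append] at hpw
  cases hd : m.drop s with
  | nil => exact Or.inl rfl
  | cons c L =>
    refine Or.inr fun t ht ht0 => ?_
    have hlt := Words.strongLexLt_of_suffix_flatten (L := m.take s) (c := c)
      (fun a ha => hpw.2.2 a ha c (by simp [hd])) (ht.trans ⟨x, hxu.symm⟩) ht0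
    simpa using hlt.append [] L.flatten
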